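/- Let $S_\infty\subseteq\omega^\omega$ be the set of permutations (bijections) of $\omega$, where $\omega^\omega$ is Baire space with the product topology of the discrete topology on $\omega$. A maximal eventually different family of permutations is a set $F\subseteq S_\infty$ such that $\{n\in\omega: f(n)=g(n)\}$ is finite for all distinct $f,g\in F$, and such that for every $g\in S_\infty$ there is $f\in F$ with $f(n)=g(n)$ for infinitely many $n$. Let $\mathbf{\Sigma}^0_\alpha,\mathbf{\Pi}^0_\alpha$ ($1\le\alpha<\omega_1$) denote the levels of the (boldface) Borel hierarchy of $\omega^\omega$: $\mathbf{\Sigma}^0_1$ sets are the open sets, $\mathbf{\Pi}^0_\alpha$ sets are the complements of $\mathbf{\Sigma}^0_\alpha$ sets, and for $\alpha>1$ the $\mathbf{\Sigma}^0_\alpha$ sets are the countable unions of sets each belonging to $\mathbf{\Pi}^0_\beta$ for some $1\le\beta<\alpha$. **Lemma.** Let $0<\xi<\omega_1$. If there is a maximal eventually different family of permutations that is $\mathbf{\Pi}^0_{\xi+2}$, then there is a maximal eventually different family of permutations that is $\mathbf{\Pi}^0_{\xi+1}$. -/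

import Mathlib

/-- The additive Borel class `𝚺⁰_ξ` (boldface) of a topological space, for an ordinal `ξ ≥ 1`:
`𝚺⁰_1` consists of the open sets and, for `ξ > 1`, `𝚺⁰_ξ` consists of the countable unions
`⋃ n, (A n)ᶜ` where each `A n` is `𝚺⁰_{ζ n}` for some `1 ≤ ζ n < ξ`
(so that `(A n)ᶜ` is `𝚷⁰_{ζ n}`). -/
inductive IsBorelSigma {X : Type*} [TopologicalSpace X] : Ordinal.{0} → Set X → Prop
  | of_isOpen (U : Set X) (hU : IsOpen U) : IsBorelSigma 1 U
  | iUnion_compl (ξ : Ordinal.{0}) (hξ : 1 < ξ) (A : ℕ → Set X) (ζ : ℕ → Ordinal.{0})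
      (hζ : ∀ n, 1 ≤ ζ n ∧ ζ n < ξ) (hA : ∀ n, IsBorelSigma (ζ n) (A n)) :
      IsBorelSigma ξ (⋃ n, (A n)ᶜ)

/-- The multiplicative Borel class `𝚷⁰_ξ` (boldface): complements of `𝚺⁰_ξ` sets. -/
def IsBorelPi {X : Type*} [TopologicalSpace X] (ξ : Ordinal.{0}) (A : Set X) : Prop :=
  IsBorelSigma ξ Aᶜ

/-- `S_∞`: the set of permutations of `ω`, as a subset of Baire space `ω^ω = ℕ → ℕ`. -/
def permutationsOfNat : Set (ℕ → ℕ) := {f | Function.Bijective f}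

/-- A family of functions is eventually different if any two distinct members agree at only
finitely many places. -/
def IsEventuallyDifferent (F : Set (ℕ → ℕ)) : Prop :=
  ∀ f ∈ F, ∀ g ∈ F, f ≠ g → {n | f n = g n}.Finite

/-- A maximal eventually different family of permutations: an eventually different family
`F ⊆ S_∞` such that every permutation agrees at infinitely many places with some member of `F`. -/
def IsMaximalEventuallyDifferentPermutations (F : Set (ℕ → ℕ)) : Prop :=
  F ⊆ permutationsOfNat ∧ IsEventuallyDifferent F ∧
    ∀ g ∈ permutationsOfNat, ∃ f ∈ F, {n | f n = g n}.Infinite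

/-!
Fix a bijection between `ℕ` and `ℕ × Bool`. For `f : ℕ → ℕ` and a sequence of bits `b`, let
`twist f b` be the function `(n, i) ↦ (f n, i xor b n)` on `ℕ × Bool`, transported to `ℕ`; it is a
permutation as soon as `f` is one.

Let `F` be a maximal eventually different family of permutations in `𝚷⁰_{ξ+2}`. Then
`F = ⋂ n, ⋃ m, T ⟨n, m⟩` with all `T p` in `𝚷⁰_{≤ ξ}`. Each `f ∈ F` yields exactly two members of the
new family, `twist f b` and `twist f (¬b)`, where the bits `b` record the truth values of `f ∈ T p`.

* The new family is eventually different: for distinct `f` because of the first coordinates, and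
  for one `f` because `twist f b` and `twist f (¬b)` agree nowhere.
* It is maximal. For a permutation `g` of `ℕ × Bool`, the bipartite graph joining `n` to the first
  coordinates of `g (n, false)` and `g (n, true)` is a 2-regular multigraph, so Hall's theorem gives
  a perfect matching `p`, a permutation of `ℕ` (`exists_bijective_selector`). Some `f ∈ F` agrees with
  `p` infinitely often, and at each such `n` one of `twist f b`, `twist f (¬b)` agrees with `g` at
  `(n, false)` or `(n, true)`. So one of the two agrees with `g` infinitely often.
* It is `𝚷⁰_{ξ+1}`: the bits are a continuous function of the member, correctness of a single bit is
  a condition on `T p` and its complement, and once the bits are correct, membership `f ∈ F` becomes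
  the `Gδ` condition `∀ n, ∃ m, bit ⟨n, m⟩ is set` (`isBorelPi_witnessedTwists`).
-/

/-! ### Closure properties of the Borel classes -/

section BorelClasses

variable {X Y : Type*} [TopologicalSpace X] [TopologicalSpace Y]

theorem IsBorelSigma.one_le {ξ : Ordinal.{0}} {A : Set X} (h : IsBorelSigma ξ A) : 1 ≤ ξ := by
  cases h with
  | of_isOpen U hU => exact le_rfl
  | iUnion_compl ξ hξ A ζ hζ hA => exact hξ.le

theorem IsBorelSigma.preimage {φ : X → Y} (hφ : Continuous φ) {ξ : Ordinal.{0}} {A : Set Y}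
    (h : IsBorelSigma ξ A) : IsBorelSigma ξ (φ ⁻¹' A) := by
  induction h with
  | of_isOpen U hU => exact .of_isOpen _ (hU.preimage hφ)
  | iUnion_compl ξ hξ A ζ hζ hA ih =>
    rw [Set.preimage_iUnion]
    exact .iUnion_compl ξ hξ (fun n => φ ⁻¹' A n) ζ hζ ih

theorem IsBorelSigma.compl {ξ η : Ordinal.{0}} (hlt : ξ < η) {A : Set X}
    (h : IsBorelSigma ξ A) : IsBorelSigma η Aᶜ := by
  have := IsBorelSigma.iUnion_compl η (h.one_le.trans_lt hlt) (fun _ => A) (fun _ => ξ)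
    (fun _ => ⟨h.one_le, hlt⟩) (fun _ => h)
  rwa [Set.iUnion_const] at this

/-- The additive classes increase. In the step from open sets to higher classes it is essential that
every open set is a countable union of closed sets. -/
theorem IsBorelSigma.mono [PerfectlyNormalSpace X] {ξ η : Ordinal.{0}} (hle : ξ ≤ η) {A : Set X}
    (h : IsBorelSigma ξ A) : IsBorelSigma η A := by
  cases h with
  | of_isOpen U hU =>
    rcases hle.eq_or_lt with rfl | hlt
    · exact .of_isOpen _ hU
    · obtain ⟨V, hV, hAV⟩ := hU.isClosed_compl.isGδ.eq_iInter_nat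
      have hA : A = ⋃ n, (V n)ᶜ := by rw [← Set.compl_iInter, ← hAV, compl_compl]
      rw [hA]
      exact .iUnion_compl η hlt V (fun _ => 1) (fun _ => ⟨le_rfl, hlt⟩)
        (fun n => .of_isOpen _ (hV n))
  | iUnion_compl ξ hξ A ζ hζ hA =>
    exact .iUnion_compl η (hξ.trans_le hle) A ζ
      (fun n => ⟨(hζ n).1, (hζ n).2.trans_le hle⟩) hA

theorem IsOpen.isBorelSigma [PerfectlyNormalSpace X] {ξ : Ordinal.{0}} (hξ : 1 ≤ ξ) {U : Set X}
    (hU : IsOpen U) : IsBorelSigma ξ U :=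
  (IsBorelSigma.of_isOpen U hU).mono hξ

theorem IsBorelSigma.isOpen_of_one {A : Set X} (h : IsBorelSigma 1 A) : IsOpen A := by
  generalize hη : (1 : Ordinal.{0}) = η at h
  cases h with
  | of_isOpen U hU => exact hU
  | iUnion_compl ξ hξ A ζ hζ hA => exact absurd hξ (hη ▸ lt_irrefl _)

theorem IsBorelSigma.exists_eq_iUnion_compl {ξ : Ordinal.{0}} (hξ : 1 < ξ) {A : Set X}
    (h : IsBorelSigma ξ A) : ∃ (B : ℕ → Set X) (ζ : ℕ → Ordinal.{0}),
      (∀ n, 1 ≤ ζ n ∧ ζ n < ξ) ∧ (∀ n, IsBorelSigma (ζ n) (B n)) ∧ A = ⋃ n, (B n)ᶜ := by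
  cases h with
  | of_isOpen U hU => exact absurd hξ (lt_irrefl 1)
  | iUnion_compl ξ hξ A ζ hζ hA => exact ⟨A, ζ, hζ, hA, rfl⟩

theorem IsBorelSigma.iUnion {ξ : Ordinal.{0}} {A : ℕ → Set X}
    (h : ∀ n, IsBorelSigma ξ (A n)) : IsBorelSigma ξ (⋃ n, A n) := by
  rcases (h 0).one_le.eq_or_lt with rfl | hξ
  · exact .of_isOpen _ (isOpen_iUnion fun n => (h n).isOpen_of_one)
  · choose B ζ hζ hB hAB using fun n => (h n).exists_eq_iUnion_compl hξ
    have hA : ⋃ n, A n = ⋃ k : ℕ, (B k.unpair.1 k.unpair.2)ᶜ := by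
      rw [Set.iUnion_unpair (fun i j => (B i j)ᶜ)]
      exact Set.iUnion_congr hAB
    rw [hA]
    exact .iUnion_compl ξ hξ _ (fun k => ζ k.unpair.1 k.unpair.2) (fun k => hζ _ _)
      (fun k => hB _ _)

theorem IsBorelSigma.union {ξ : Ordinal.{0}} {A B : Set X} (hA : IsBorelSigma ξ A)
    (hB : IsBorelSigma ξ B) : IsBorelSigma ξ (A ∪ B) := by
  have hAB : A ∪ B = ⋃ n : ℕ, if n = 0 then A else B := by
    ext x
    simp only [Set.mem_union, Set.mem_iUnion]
    constructor
    · rintro (hx | hx)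
      · exact ⟨0, by simpa using hx⟩
      · exact ⟨1, by simpa using hx⟩
    · rintro ⟨n, hn⟩
      split_ifs at hn
      exacts [.inl hn, .inr hn]
  rw [hAB]
  refine .iUnion fun n => ?_
  split_ifs
  exacts [hA, hB]

theorem IsBorelSigma.inter_isClopen [PerfectlyNormalSpace X] {ξ : Ordinal.{0}} {A V : Set X}
    (hA : IsBorelSigma ξ A) (hV : IsClopen V) : IsBorelSigma ξ (A ∩ V) := by
  cases hA with
  | of_isOpen U hU => exact .of_isOpen _ (hU.inter hV.isOpen)
  | iUnion_compl ξ hξ A ζ hζ hA =>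
    have h : (⋃ n, (A n)ᶜ) ∩ V = ⋃ n, (A n ∪ Vᶜ)ᶜ := by
      simp [Set.iUnion_inter, Set.compl_union]
    rw [h]
    exact .iUnion_compl ξ hξ _ ζ hζ fun n =>
      (hA n).union (hV.compl.isOpen.isBorelSigma (hζ n).1)

/-- A `𝚷⁰_{ξ+2}` set has the form `⋂ n, ⋃ m, T ⟨n, m⟩` with every `T p` of multiplicative class
at most `ξ`; the pairs are coded by natural numbers. -/
theorem IsBorelPi.exists_forall_exists_mem [PerfectlyNormalSpace X] {ξ : Ordinal.{0}} (hξ : 0 < ξ)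
    {A : Set X} (h : IsBorelPi (ξ + 2) A) : ∃ T : ℕ → Set X,
      (∀ p, ∃ ζ < ξ + 1, IsBorelSigma ζ (T p)ᶜ) ∧
        ∀ x, x ∈ A ↔ ∀ n, ∃ m, x ∈ T (Nat.pair n m) := by
  have h1 : (1 : Ordinal.{0}) < ξ + 1 :=
    Order.lt_add_one_iff.2 (Order.one_le_iff_pos.2 hξ)
  have h2 : ξ + 2 = ξ + 1 + 1 := by rw [add_assoc, one_add_one_eq_two]
  have h12 : ξ + 1 < ξ + 2 := h2 ▸ Order.lt_add_one_iff.2 le_rfl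
  obtain ⟨B, ζ, hζ, hB, hAB⟩ := IsBorelSigma.exists_eq_iUnion_compl (h1.trans h12) h
  have hB' : ∀ n, IsBorelSigma (ξ + 1) (B n) := fun n =>
    (hB n).mono (Order.lt_add_one_iff.1 (h2 ▸ (hζ n).2))
  choose C η hη hC hBC using fun n => (hB' n).exists_eq_iUnion_compl h1
  refine ⟨fun p => (C p.unpair.1 p.unpair.2)ᶜ, fun p =>
    ⟨_, (hη p.unpair.1 p.unpair.2).2, ?_⟩, fun x => ?_⟩
  · simpa using hC p.unpair.1 p.unpair.2
  · rw [← compl_compl A, hAB]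
    simp [hBC]

end BorelClasses

/-! ### A perfect matching for permutations of `ℕ × Bool` -/

/-- Hall's condition holds since `g` embeds `s × Bool` into `t × Bool`, where `t` consists of the
first coordinates of values of `g` on `s × Bool`. -/
theorem exists_injective_selector {α β : Type*} {g : α × Bool → β × Bool}
    (hg : Function.Injective g) :
    ∃ p : α → β, Function.Injective p ∧ ∀ a, ∃ i, (g (a, i)).1 = p a := by
  classical
  let t : α → Finset β := fun a => Finset.univ.image fun i => (g (a, i)).1
  obtain ⟨p, hp, hpt⟩ := (Finset.all_card_le_biUnion_card_iff_exists_injective t).1 fun s => by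
    have hcard : (s ×ˢ (Finset.univ : Finset Bool)).card
        ≤ (s.biUnion t ×ˢ (Finset.univ : Finset Bool)).card := by
      refine Finset.card_le_card_of_injOn g (fun x hx => ?_) hg.injOn
      have hx' : x.1 ∈ s := by simpa using hx
      have : (g x).1 ∈ s.biUnion t :=
        Finset.mem_biUnion.2 ⟨x.1, hx', Finset.mem_image.2 ⟨x.2, Finset.mem_univ _, rfl⟩⟩
      simpa using this
    simpa [Finset.card_product] using hcard
  exact ⟨p, hp, fun a => by simpa only [t, Finset.mem_image, Finset.mem_univ, true_and] using hpt a⟩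

/-- Selectors of `g` and of its inverse are combined along the relation
"`b` is the first coordinate of some `g (a, i)`". -/
theorem exists_bijective_selector {α β : Type*} (g : α × Bool ≃ β × Bool) :
    ∃ p : α → β, Function.Bijective p ∧ ∀ a, ∃ i, (g (a, i)).1 = p a := by
  obtain ⟨p, hp, hpg⟩ := exists_injective_selector g.injective
  obtain ⟨q, hq, hqg⟩ := exists_injective_selector g.symm.injective
  refine Function.Embedding.schroeder_bernstein_of_rel hp hq
    (fun a b => ∃ i, (g (a, i)).1 = b) hpg fun b => ?_
  obtain ⟨i, hi⟩ := hqg b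
  exact ⟨(g.symm (b, i)).2, by rw [← hi]; simp⟩

/-! ### Twisting a function by a sequence of bits -/

/-- The fixed identification of two copies of `ℕ` with `ℕ`. -/
def doubling : ℕ × Bool ≃ ℕ :=
  (Equiv.prodComm ℕ Bool).trans Equiv.boolProdNatEquivNat

/-- The function `(n, i) ↦ (f n, i xor b n)`, transported from `ℕ × Bool` to `ℕ`. -/
def twist (f : ℕ → ℕ) (b : ℕ → Bool) : ℕ → ℕ := fun k =>
  doubling (f (doubling.symm k).1, xor (doubling.symm k).2 (b (doubling.symm k).1))

/-- The function `f` of `twist f b`. -/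
def untwist (h : ℕ → ℕ) : ℕ → ℕ := fun n => (doubling.symm (h (doubling (n, false)))).1

/-- The bits `b` of `twist f b`. -/
def twistBit (h : ℕ → ℕ) : ℕ → Bool := fun n => (doubling.symm (h (doubling (n, false)))).2

theorem twist_doubling (f : ℕ → ℕ) (b : ℕ → Bool) (n : ℕ) (i : Bool) :
    twist f b (doubling (n, i)) = doubling (f n, xor i (b n)) := by
  simp [twist]

theorem untwist_twist (f : ℕ → ℕ) (b : ℕ → Bool) : untwist (twist f b) = f := by
  funext n; simp [untwist, twist]

theorem twistBit_twist (f : ℕ → ℕ) (b : ℕ → Bool) : twistBit (twist f b) = b := by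
  funext n; simp [twistBit, twist]

theorem continuous_untwist : Continuous untwist :=
  continuous_pi fun n => (continuous_of_discreteTopology
    (f := fun k => (doubling.symm k).1)).comp (continuous_apply (doubling (n, false)))

theorem continuous_twistBit (n : ℕ) : Continuous fun h => twistBit h n :=
  (continuous_of_discreteTopology
    (f := fun k => (doubling.symm k).2)).comp (continuous_apply (doubling (n, false)))

/-- The range of `twist` is described by closed conditions, one for each pair of points
`(n, false)`, `(n, true)`. -/
theorem eq_twist_iff (h : ℕ → ℕ) : h = twist (untwist h) (twistBit h) ↔
    ∀ n, h (doubling (n, true)) = doubling (untwist h n, !twistBit h n) := by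
  constructor
  · intro hh n
    conv_lhs => rw [hh]
    simp [twist_doubling]
  · intro hh
    funext k
    obtain ⟨⟨n, i⟩, rfl⟩ := doubling.surjective k
    cases i
    · simp [twist_doubling, untwist, twistBit]
    · simp [twist_doubling, hh]

theorem bijective_twist {f : ℕ → ℕ} (hf : Function.Bijective f) (b : ℕ → Bool) :
    Function.Bijective (twist f b) := by
  constructor
  · intro k l hkl
    have h := doubling.injective hkl
    simp only [Prod.mk.injEq] at h
    have h1 := hf.1 h.1
    refine doubling.symm.injective (Prod.ext h1 ?_)
    simpa [h1] using h.2
  · intro k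
    obtain ⟨n, hn⟩ := hf.2 (doubling.symm k).1
    refine ⟨doubling (n, xor (doubling.symm k).2 (b n)), ?_⟩
    rw [twist_doubling, hn]
    simp

theorem finite_eq_twist {f f' : ℕ → ℕ} (b b' : ℕ → Bool) (h : {n | f n = f' n}.Finite) :
    {k | twist f b k = twist f' b' k}.Finite := by
  refine ((h.prod (Set.finite_univ (α := Bool))).image doubling).subset fun k hk => ?_
  have hk' := congrArg Prod.fst (doubling.injective hk)
  exact ⟨doubling.symm k, ⟨hk', trivial⟩, by simp⟩

theorem twist_not_ne (f : ℕ → ℕ) (b : ℕ → Bool) (k : ℕ) :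
    twist f b k ≠ twist f (fun n => !b n) k := by
  intro hk
  have := congrArg Prod.snd (doubling.injective hk)
  simp at this

/-- A permutation `g` determines a permutation `p` such that every `f` agreeing with `p` infinitely
often has, for any bits `b`, a twist by `b` or by `¬b` agreeing with `g` infinitely often. -/
theorem exists_bijective_forall_infinite_eq_twist {g : ℕ → ℕ} (hg : Function.Bijective g) :
    ∃ p : ℕ → ℕ, Function.Bijective p ∧ ∀ f, {n | f n = p n}.Infinite → ∀ b : ℕ → Bool,
      {k | twist f b k = g k}.Infinite ∨ {k | twist f (fun n => !b n) k = g k}.Infinite := by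
  obtain ⟨p, hp, hpg⟩ := exists_bijective_selector
    ((doubling.trans (Equiv.ofBijective g hg)).trans doubling.symm)
  refine ⟨p, hp, fun f hf b => ?_⟩
  by_contra! hfin
  refine hf (((hfin.1.union hfin.2).image fun k => (doubling.symm k).1).subset fun n hn => ?_)
  obtain ⟨i, hi⟩ := hpg n
  refine ⟨doubling (n, i), ?_, by simp⟩
  have hi' : (doubling.symm (g (doubling (n, i)))).1 = f n := hi.trans (Eq.symm hn)
  have hgn : g (doubling (n, i)) = doubling (f n, (doubling.symm (g (doubling (n, i)))).2) := by
    rw [← hi']; simp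
  simp only [Set.mem_union, Set.mem_ofPred_eq, twist_doubling]
  rw [hgn]
  generalize (doubling.symm (g (doubling (n, i)))).2 = j
  cases i <;> cases j <;> cases b n <;> simp

/-! ### The family of witnessed twists -/

open Classical in
/-- The two bit sequences recording which of the sets `T p` contain `f`: the bit at `p + 1` equals the
bit `c` at `0` if and only if `f ∈ T p`. -/
noncomputable def witnessBits (T : ℕ → Set (ℕ → ℕ)) (f : ℕ → ℕ) (c : Bool) : ℕ → Bool
  | 0 => c
  | p + 1 => xor c (decide (f ∉ T p))

/-- The twists of the members `f` of `F` by the two bit sequences that record membership of `f` in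
the sets `T p`. -/
def witnessedTwists (T : ℕ → Set (ℕ → ℕ)) (F : Set (ℕ → ℕ)) : Set (ℕ → ℕ) :=
  {h | ∃ f ∈ F, ∃ c, h = twist f (witnessBits T f c)}

theorem witnessBits_not (T : ℕ → Set (ℕ → ℕ)) (f : ℕ → ℕ) (c : Bool) :
    witnessBits T f (!c) = fun n => !witnessBits T f c n := by
  funext n
  cases n <;> simp [witnessBits]

theorem witnessBits_succ_eq_iff (T : ℕ → Set (ℕ → ℕ)) (f : ℕ → ℕ) (c : Bool) (p : ℕ) :
    witnessBits T f c (p + 1) = witnessBits T f c 0 ↔ f ∈ T p := by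
  by_cases h : f ∈ T p <;> simp [witnessBits, h]

theorem eq_witnessBits {T : ℕ → Set (ℕ → ℕ)} {f : ℕ → ℕ} {b : ℕ → Bool}
    (h : ∀ p, b (p + 1) = b 0 ↔ f ∈ T p) : b = witnessBits T f (b 0) := by
  funext n
  cases n with
  | zero => rfl
  | succ p =>
    have hp := (h p).trans (witnessBits_succ_eq_iff T f (b 0) p).symm
    change _ ↔ _ = b 0 at hp
    revert hp
    cases b (p + 1) <;> cases b 0 <;> simp

/-- Once the bits are known to be correct, membership of `f` in `F` can be read off the bits. -/
theorem mem_witnessedTwists_iff {T : ℕ → Set (ℕ → ℕ)} {F : Set (ℕ → ℕ)}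
    (hF : ∀ f, f ∈ F ↔ ∀ n, ∃ m, f ∈ T (Nat.pair n m)) (h : ℕ → ℕ) :
    h ∈ witnessedTwists T F ↔
      (∀ n, h (doubling (n, true)) = doubling (untwist h n, !twistBit h n)) ∧
      (∀ p, twistBit h (p + 1) = twistBit h 0 ↔ untwist h ∈ T p) ∧
      ∀ n, ∃ m, twistBit h (Nat.pair n m + 1) = twistBit h 0 := by
  rw [← eq_twist_iff]
  constructor
  · rintro ⟨f, hf, c, rfl⟩
    simp only [untwist_twist, twistBit_twist, witnessBits_succ_eq_iff, implies_true, true_and]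
    exact (hF f).1 hf
  · rintro ⟨h1, h2, h3⟩
    refine ⟨untwist h, (hF _).2 fun n => ?_, twistBit h 0, ?_⟩
    · obtain ⟨m, hm⟩ := h3 n
      exact ⟨m, (h2 _).1 hm⟩
    · rw [← eq_witnessBits h2]
      exact h1

theorem isBorelPi_witnessedTwists {ξ : Ordinal.{0}} {T : ℕ → Set (ℕ → ℕ)}
    {F : Set (ℕ → ℕ)} (hξ : 0 < ξ) (hT : ∀ p, ∃ ζ < ξ + 1, IsBorelSigma ζ (T p)ᶜ)
    (hF : ∀ f, f ∈ F ↔ ∀ n, ∃ m, f ∈ T (Nat.pair n m)) :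
    IsBorelPi (ξ + 1) (witnessedTwists T F) := by
  have h1 : (1 : Ordinal.{0}) < ξ + 1 :=
    Order.lt_add_one_iff.2 (Order.one_le_iff_pos.2 hξ)
  let E : ℕ → Set (ℕ → ℕ) := fun p => {h | twistBit h (p + 1) = twistBit h 0}
  have hE : ∀ p, IsClopen (E p) := fun p =>
    (isClopen_discrete {x : Bool × Bool | x.1 = x.2}).preimage
      ((continuous_twistBit (p + 1)).prodMk (continuous_twistBit 0))
  let K : ℕ → Set (ℕ → ℕ) := fun n =>
    {h | h (doubling (n, true)) = doubling (untwist h n, !twistBit h n)}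
  have hK : ∀ n, IsClosed (K n) := fun n =>
    isClosed_eq (continuous_apply _) ((continuous_of_discreteTopology
      (f := fun x : ℕ × Bool => doubling (x.1, !x.2))).comp
        (((continuous_apply n).comp continuous_untwist).prodMk (continuous_twistBit n)))
  -- The double complement exhibits the preimage of `T p`, known only to be the complement of a lower
  -- additive set, as a member of `𝚺⁰_{ξ+1}`.
  have hcompl : (witnessedTwists T F)ᶜ =
      ((⋃ n, (K n)ᶜ) ∪ ⋃ p, ((untwist ⁻¹' (T p)ᶜ) ∩ E p) ∪ ((untwist ⁻¹' (T p)ᶜ)ᶜ ∩ (E p)ᶜ)) ∪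
        ⋃ n, (⋃ m, E (Nat.pair n m))ᶜ := by
    ext h
    rw [Set.mem_compl_iff, mem_witnessedTwists_iff hF]
    simp only [Set.mem_union, Set.mem_iUnion, Set.mem_inter_iff, Set.mem_compl_iff,
      Set.mem_preimage, E, K, Set.mem_ofPred_eq, not_and_or, not_forall, not_exists, not_not,
      or_assoc]
    refine or_congr Iff.rfl (or_congr (exists_congr fun p => ?_) Iff.rfl)
    tauto
  change IsBorelSigma (ξ + 1) (witnessedTwists T F)ᶜ
  rw [hcompl]
  refine ((IsBorelSigma.iUnion fun n => (hK n).isOpen_compl.isBorelSigma h1.le).union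
    (.iUnion fun p => ?_)).union (.iUnion fun n => ?_)
  · obtain ⟨ζ, hζ, hTζ⟩ := hT p
    have hpre := hTζ.preimage continuous_untwist
    exact ((hpre.mono hζ.le).inter_isClopen (hE p)).union
      ((hpre.compl hζ).inter_isClopen (hE p).compl)
  · exact (IsBorelSigma.of_isOpen _ (isOpen_iUnion fun m => (hE _).isOpen)).compl h1

theorem IsMaximalEventuallyDifferentPermutations.witnessedTwists {F : Set (ℕ → ℕ)}
    (hF : IsMaximalEventuallyDifferentPermutations F) (T : ℕ → Set (ℕ → ℕ)) :
    IsMaximalEventuallyDifferentPermutations (witnessedTwists T F) := by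
  obtain ⟨hperm, hdiff, hmax⟩ := hF
  refine ⟨?_, ?_, fun g hg => ?_⟩
  · rintro _ ⟨f, hf, c, rfl⟩
    exact bijective_twist (hperm hf) _
  · rintro _ ⟨f, hf, c, rfl⟩ _ ⟨f', hf', c', rfl⟩ hne
    by_cases hff : f = f'
    · subst hff
      have hc : c' = !c := by
        cases c <;> cases c' <;> simp_all
      subst hc
      rw [witnessBits_not]
      simp [twist_not_ne]
    · exact finite_eq_twist _ _ (hdiff f hf f' hf' hff)
  · obtain ⟨p, hp, hpg⟩ := exists_bijective_forall_infinite_eq_twist hg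
    obtain ⟨f, hf, hfp⟩ := hmax p hp
    rcases hpg f hfp (witnessBits T f false) with h | h
    · exact ⟨_, ⟨f, hf, false, rfl⟩, h⟩
    · rw [← witnessBits_not] at h
      exact ⟨_, ⟨f, hf, _, rfl⟩, h⟩

theorem mainTheorem7 (ξ : Ordinal.{0}) (hξ_pos : 0 < ξ) (hξ_lt : ξ < Ordinal.omega 1)
    (h : ∃ F : Set (ℕ → ℕ), IsMaximalEventuallyDifferentPermutations F ∧ IsBorelPi (ξ + 2) F) :
    ∃ F : Set (ℕ → ℕ), IsMaximalEventuallyDifferentPermutations F ∧ IsBorelPi (ξ + 1) F := by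
  obtain ⟨F, hF, hFξ⟩ := h
  obtain ⟨T, hT, hFT⟩ := hFξ.exists_forall_exists_mem hξ_pos
  exact ⟨witnessedTwists T F, hF.witnessedTwists T, isBorelPi_witnessedTwists hξ_pos hT hFT⟩
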